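/- Let $\mathcal G=(\mathcal V,\mathcal E)$ be a strongly connected digraph with $n\ge 2$ nodes and without self-loops, where $(v_j,v_i)\in\mathcal E$ denotes an edge from $v_i$ to $v_j$, and let real limits $0<l_{ji}\le u_{ji}$ be given on the edges. Write $\mathcal N_j^-$ and $\mathcal N_j^+$ for the in- and out-neighbors of $v_j$, and $\mathcal D_j=|\mathcal N_j^-|+|\mathcal N_j^+|$. Assume the integer circulation conditions: $\lceil l_{ji}\rceil\le\lfloor u_{ji}\rfloor$ on every edge $(v_j,v_i)\in\mathcal E$, and for every $\mathcal S\subseteq\mathcal V$ the sum of $\lceil l_{ji}\rceil$ over the edges entering $\mathcal S$ is at most the sum of $\lfloor u_{lj}\rfloor$ over the edges leaving $\mathcal S$. Consider the following distributed algorithm. The tail $v_i$ of each edge $(v_j,v_i)$ holds the actual integer flow $f_{ji}[k]$ and the head $v_j$ holds a perceived integer flow $f^{(p)}_{ji}[k]$, with $f_{ji}[0]=f^{(p)}_{ji}[0]=\lceil l_{ji}\rceil$. Each node $v_j$ fixes an arbitrary order of its $\mathcal D_j$ incoming and outgoing edges, which it uses cyclically, beginning with the first edge. At each iteration $k=0,1,2,\dots$,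 all nodes $v_j$ simultaneously do the following. 1. Node $v_j$ computes its perceived balance $b^{(p)}_j[k]=\sum_{v_i\in\mathcal N_j^-}f^{(p)}_{ji}[k]-\sum_{v_l\in\mathcal N_j^+}f_{lj}[k]$. 2. If $b_j^{(p)}[k]>0$, node $v_j$ goes through its edges in its cyclic order, starting with the edge that follows the last one it treated in the past, and tentatively adds $1$ to the flow it holds for an outgoing edge (unless that flow has reached $\lfloor u_{lj}\rfloor$) or subtracts $1$ from the flow it holds for an incoming edge (unless that flow has reached $\lceil l_{ji}\rceil$), one edge at a time, until its perceived balance, computed with the tentative flows, is zero. This yields desired changes $c^{(j)}_{lj}[k]\ge 0$ and $c^{(j)}_{ji}[k]\le 0$ on its outgoing and incoming edges, which it transmits to the other endpoint of each edge. If $b_j^{(p)}[k]\le 0$, all of its desired changes are $0$. 3. The change for an edge sent at iteration $k_0$ by an endpoint $v$ arrives at the other endpoint at iteration $k_0+\tau$, where the integer delay $\tau\ge 0$ may depend arbitrarily on the edge, on the direction and on $k_0$, but is at most a fixed bound $\overline\tau<\infty$. Let $\overline c^{(v)}[k]$ be the sum of the changes for that edge sent by $v$ that arrive at iteration $k$.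 4. For each edge $(v_j,v_i)\in\mathcal E$, the endpoints set $f_{ji}[k+1]$ and $f^{(p)}_{ji}[k+1]$ to the projections of $f_{ji}[k]+c^{(i)}_{ji}[k]+\overline c^{(j)}_{ji}[k]$ and $f^{(p)}_{ji}[k]+c^{(j)}_{ji}[k]+\overline c^{(i)}_{ji}[k]$, respectively, onto $[\lceil l_{ji}\rceil,\lfloor u_{ji}\rfloor]$. Then, for all choices of the orders and of the delays, the algorithm balances the flows in finitely many steps: there is a $k_0$ such that for all $k\ge k_0$ one has $f_{ji}[k]=f_{ji}[k_0]$ and $0<l_{ji}\le f_{ji}[k]\le u_{ji}$ on every edge $(v_j,v_i)\in\mathcal E$, and the balance $b_j[k]=\sum_{v_i\in\mathcal N_j^-}f_{ji}[k]-\sum_{v_l\in\mathcal N_j^+}f_{lj}[k]$ is $0$ for every node $v_j\in\mathcal V$. -/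

import Mathlib

namespace FlowBalancing

/-- A directed graph on `V` with a real lower and upper limit on every edge. A pair `(j, i)` in
`E` is the edge *from* `i` *to* `j`: its head is `j` (first component), its tail is `i` (second
component). There are no self-loops. The values of `l` and `u` outside `E` are never used. -/
structure Network (V : Type*) where
  /-- The set of edges. -/
  E : Finset (V × V)
  /-- The lower limits. -/
  l : V × V → ℝ
  /-- The upper limits. -/
  u : V × V → ℝ
  loopless : ∀ v : V, (v, v) ∉ E

section

variable {V : Type*}

/-- From every node there is a directed path to every other node. -/
def Network.StronglyConnected (N : Network V) : Prop :=
  ∀ i j : V, i ≠ j → Relation.TransGen (fun a b => (b, a) ∈ N.E) i j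

end

section

variable {V : Type*} [Fintype V] [DecidableEq V]

/-- The integer circulation conditions: (i) `⌈l⌉ ≤ ⌊u⌋` on every edge, and (ii) for every set `S`
of nodes, the sum of `⌈l⌉` over the edges entering `S` is at most the sum of `⌊u⌋` over the edges
leaving `S`. -/
def Network.CirculationConditions (N : Network V) : Prop :=
  (∀ e ∈ N.E, ⌈N.l e⌉ ≤ ⌊N.u e⌋) ∧
  ∀ S : Finset V,
    ∑ e ∈ N.E with e.1 ∈ S ∧ e.2 ∉ S, ⌈N.l e⌉ ≤ ∑ e ∈ N.E with e.2 ∈ S ∧ e.1 ∉ S, ⌊N.u e⌋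

/-- In-neighbours of `j`. -/
def Network.inNbrs (N : Network V) (j : V) : Finset V := {i | (j, i) ∈ N.E}

/-- Out-neighbours of `j`. -/
def Network.outNbrs (N : Network V) (j : V) : Finset V := {m | (m, j) ∈ N.E}

/-- The incoming and outgoing edges of `j`. -/
def Network.incident (N : Network V) (j : V) : Finset (V × V) := {e ∈ N.E | e.1 = j ∨ e.2 = j}

/-- Total degree of `j`. -/
def Network.degree (N : Network V) (j : V) : ℕ := (N.inNbrs j).card + (N.outNbrs j).card

/-- The flow balance (in-flow minus out-flow) of `j`, when the incoming flows are read from `g`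
and the outgoing flows from `f`. -/
def Network.balance₂ (N : Network V) (g f : V × V → ℤ) (j : V) : ℤ :=
  ∑ i ∈ N.inNbrs j, g (j, i) - ∑ m ∈ N.outNbrs j, f (m, j)

/-- The flow balance of `j` under the flow assignment `f`. -/
def Network.balance (N : Network V) (f : V × V → ℤ) (j : V) : ℤ := N.balance₂ f f j

/-- `P j e` is the position of the edge `e` in the order that `j` has chosen for its incoming and
outgoing edges: the positions of these edges fill `{0, …, degree j - 1}` (and are
therefore pairwise different). -/
def Network.IsEdgeOrder (N : Network V) (P : V → V × V → ℕ) : Prop :=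
  ∀ j : V, (N.incident j).image (P j) = Finset.range (N.degree j)

/-- Projection of an integer flow value onto the feasible integers of the edge `e`. -/
noncomputable def Network.proj (N : Network V) (e : V × V) (x : ℤ) : ℤ :=
  max ⌈N.l e⌉ (min ⌊N.u e⌋ x)

/-- The working memory of a node that is selecting its desired flows: the flow values that it
currently wants on its incident edges, and the position, in its cyclic order, of the edge whose
turn is next. -/
structure Scan (V : Type*) where
  /-- Desired flows. -/
  g : V × V → ℤ
  /-- Position of the next edge. -/
  pos : ℕ

/-- One unit change of the edge `e` by the node `j`, which holds the value `x` for it: an outgoing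
edge is increased by one unless it is at its maximum, an incoming edge is decreased by one unless
it is at its minimum. -/
noncomputable def Network.unitChange (N : Network V) (j : V) (e : V × V) (x : ℤ) : ℤ :=
  if e.2 = j then (if x < ⌊N.u e⌋ then x + 1 else x)
  else (if ⌈N.l e⌉ < x then x - 1 else x)

/-- One attempt of `j` in its round-robin: as long as its balance is positive, it performs a unit
change (if possible) on the edge whose turn it is and passes on to the next edge in its cyclic
order. Once the balance is not positive, it has stopped. -/
noncomputable def Network.attempt (N : Network V) (P : V → V × V → ℕ) (j : V) (s : Scan V) :
    Scan V :=
  if 0 < N.balance s.g j then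
    { g := fun e => if e ∈ N.incident j ∧ P j e = s.pos then N.unitChange j e (s.g e) else s.g e
      pos := (s.pos + 1) % N.degree j }
  else s

/-- The global state of the algorithm at the beginning of an iteration. -/
structure State (V : Type*) where
  /-- `f e` is the actual flow, held by the tail of `e`. -/
  f : V × V → ℤ
  /-- `p e` is the perceived flow, held by the head of `e`. -/
  p : V × V → ℤ
  /-- `pos j` is the position at which `j` continues its round-robin. -/
  pos : V → ℕ
  /-- `sent v e k` is the change amount for `e` that its endpoint `v` sent to the other endpoint
  in the earlier iteration `k` (`0` if nothing was sent). -/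
  sent : V → V × V → ℕ → ℤ

/-- The perceived flow balance of `j`. -/
def Network.perceivedBalance (N : Network V) (s : State V) (j : V) : ℤ := N.balance₂ s.p s.f j

/-- The flow values known to `j`: the actual flow on its outgoing edges and the perceived flow on
its incoming edges. -/
def State.view (s : State V) (j : V) : V × V → ℤ := fun e => if e.2 = j then s.f e else s.p e

/-- The outcome of the round-robin of `j`: unit changes one at a time, starting where it
stopped the previous time, until its balance is zero.
If the perceived balance `b` is positive, each `degree j` successive attempts go through all
incident edges, so they lower the balance by at least one unless all edges are saturated; hence
`b * degree j` attempts always bring the process to its end. If `b ≤ 0`, nothing is done. -/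
noncomputable def Network.select (N : Network V) (P : V → V × V → ℕ) (s : State V) (j : V) :
    Scan V :=
  (N.attempt P j)^[(N.perceivedBalance s j).toNat * N.degree j] ⟨s.view j, s.pos j⟩

/-- The change amount that `j` desires on the edge `e`. -/
noncomputable def Network.change (N : Network V) (P : V → V × V → ℕ) (s : State V) (j : V)
    (e : V × V) : ℤ :=
  (N.select P s j).g e - s.view j e

/-- The sum of the change amounts for `e` sent by its endpoint `v` that reach the other endpoint
in iteration `k`; the one sent in iteration `k₀` arrives in iteration `k₀ + τ v e k₀`. -/
def received (τ : V → V × V → ℕ → ℕ) (τbar : ℕ) (sent : V → V × V → ℕ → ℤ) (v : V) (e : V × V)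
    (k : ℕ) : ℤ :=
  ∑ k₀ ∈ Finset.Icc (k - τbar) k with k₀ + τ v e k₀ = k, sent v e k₀

/-- The initial state: all flows and perceived flows are `⌈l⌉`, every node is at the beginning of
its order and nothing has been sent. -/
noncomputable def Network.start (N : Network V) : State V where
  f := fun e => if e ∈ N.E then ⌈N.l e⌉ else 0
  p := fun e => if e ∈ N.E then ⌈N.l e⌉ else 0
  pos := fun _ => 0
  sent := fun _ _ _ => 0

/-- The change amounts sent up to and including iteration `k`, given the state at its beginning. -/
noncomputable def Network.sentNow (N : Network V) (P : V → V × V → ℕ) (k : ℕ) (s : State V) :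
    V → V × V → ℕ → ℤ :=
  fun v e => Function.update (s.sent v e) k (N.change P s v e)

/-- Iteration `k`: all nodes select and send their desired changes, receive the possibly delayed
changes of their neighbours, add both to the flows and perceived flows they hold, and project
onto the feasible interval. -/
noncomputable def Network.step (N : Network V) (P : V → V × V → ℕ) (τ : V → V × V → ℕ → ℕ)
    (τbar : ℕ) (k : ℕ) (s : State V) : State V where
  f := fun e =>
    if e ∈ N.E then
      N.proj e (s.f e + N.change P s e.2 e + received τ τbar (N.sentNow P k s) e.1 e k)
    else 0
  p := fun e =>
    if e ∈ N.E then
      N.proj e (s.p e + N.change P s e.1 e + received τ τbar (N.sentNow P k s) e.2 e k)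
    else 0
  pos := fun j => (N.select P s j).pos
  sent := N.sentNow P k s

/-- The state of the algorithm at the beginning of iteration `k`. -/
noncomputable def Network.run (N : Network V) (P : V → V × V → ℕ) (τ : V → V × V → ℕ → ℕ)
    (τbar : ℕ) : ℕ → State V
  | 0 => N.start
  | k + 1 => N.step P τ τbar k (Network.run N P τ τbar k)

/-- The actual flow on the edge `e` at the beginning of iteration `k`. -/
noncomputable def Network.flow (N : Network V) (P : V → V × V → ℕ) (τ : V → V × V → ℕ → ℕ)
    (τbar : ℕ) (k : ℕ) (e : V × V) : ℤ :=
  (N.run P τ τbar k).f e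

end

end FlowBalancing

/-! On each edge the tail only ever increases the flow and the head only ever decreases it. Each
endpoint counts its own changes in full and those of the other only as far as they have arrived, so
the perceived flow never exceeds the actual one, and the projections never act (`run_flow_eq`). A
perceived balance that is nonnegative stays so: a node's own changes stop at zero, and received
changes can only raise it (`perceivedBalance_nonneg_succ`).

Let `S` be the set of nodes whose perceived balance is positive infinitely often. On an edge between
`S` and its complement, the endpoint outside `S` eventually stops acting. The flow limits then bound
the total change made by the endpoint in `S`, which by integrality stops as well, and once all
messages have arrived the flow is constant and agreed upon. The round-robin of the endpoint in `S`
keeps coming back to this edge, so the edge must be saturated (`frequently_saturated`). Hence edges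
entering `S` end at their lower limits and edges leaving `S` at their upper limits, and the
circulation condition for `S` makes the total perceived balance of `S` nonpositive
(`sum_balance₂_nonpos`). But it is a sum of nonnegative terms, one of which is positive at
arbitrarily late times if `S` is nonempty. So `S` is empty (`eventually_perceivedBalance_nonpos`).

All changes therefore cease, both views of the flow agree, and every balance is nonpositive.
Balances add up to zero, so each of them is zero. -/

open Finset

namespace FlowBalancing

/-! ### Integer sequences: delayed partial sums and termination arguments -/

section Sequences

/-- The part of the amounts `x 0, …, x (k - 1)`, of which `x t` is delayed by `τ t`, that has
arrived before time `k`. -/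
def arrived (x : ℕ → ℤ) (τ : ℕ → ℕ) (k : ℕ) : ℤ :=
  ∑ t ∈ range k, if t + τ t < k then x t else 0

/-- The added sum is what arrives at time `k`; it includes `t = k` because delays may be zero. -/
theorem arrived_succ (x : ℕ → ℤ) (τ : ℕ → ℕ) (k : ℕ) :
    arrived x τ (k + 1) =
      arrived x τ k + ∑ t ∈ range (k + 1), if t + τ t = k then x t else 0 := by
  have h : arrived x τ k = ∑ t ∈ range (k + 1), if t + τ t < k then x t else 0 := by
    rw [sum_range_succ, if_neg (by omega), add_zero, arrived]
  rw [h, arrived, ← sum_add_distrib]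
  refine sum_congr rfl fun t _ => ?_
  split_ifs <;> omega

theorem arrived_le_sum {x : ℕ → ℤ} (hx : ∀ t, 0 ≤ x t) (τ : ℕ → ℕ) (k : ℕ) :
    arrived x τ k ≤ ∑ t ∈ range k, x t :=
  sum_le_sum fun t _ => by split_ifs <;> simp [hx t]

theorem sum_le_arrived {x : ℕ → ℤ} (hx : ∀ t, x t ≤ 0) (τ : ℕ → ℕ) (k : ℕ) :
    ∑ t ∈ range k, x t ≤ arrived x τ k :=
  sum_le_sum fun t _ => by split_ifs <;> simp [hx t]

theorem arrived_eq_sum {x : ℕ → ℤ} {τ : ℕ → ℕ} {τbar K k : ℕ} (hτ : ∀ t, τ t ≤ τbar)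
    (hx : ∀ t ≥ K, x t = 0) (hk : K + τbar ≤ k) : arrived x τ k = ∑ t ∈ range k, x t := by
  refine sum_congr rfl fun t _ => ?_
  split_ifs with h
  · rfl
  · exact (hx t (by have := hτ t; omega)).symm

theorem sum_range_eq_of_eventually_zero {x : ℕ → ℤ} {K k : ℕ} (hx : ∀ t ≥ K, x t = 0)
    (hk : K ≤ k) : ∑ t ∈ range k, x t = ∑ t ∈ range K, x t := by
  induction k, hk using Nat.le_induction with
  | base => rfl
  | succ k hk ih => rw [sum_range_succ, ih, hx k hk, add_zero]

theorem sum_range_le_of_eventually_zero {x : ℕ → ℤ} {K : ℕ} (h0 : ∀ t, 0 ≤ x t)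
    (hx : ∀ t ≥ K, x t = 0) (k : ℕ) : ∑ t ∈ range k, x t ≤ ∑ t ∈ range K, x t := by
  rcases le_total K k with h | h
  · exact (sum_range_eq_of_eventually_zero hx h).le
  · exact sum_le_sum_of_subset_of_nonneg (range_mono h) fun t _ _ => h0 t

/-- Integrality is essential: each nonzero term raises the partial sums by at least one. -/
theorem eventually_zero_of_sum_range_le {x : ℕ → ℤ} {B : ℤ} (h0 : ∀ t, 0 ≤ x t)
    (hB : ∀ k, ∑ t ∈ range k, x t ≤ B) : ∃ K, ∀ t ≥ K, x t = 0 := by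
  by_contra! h
  have key : ∀ n : ℕ, ∃ k, (n : ℤ) ≤ ∑ t ∈ range k, x t := by
    intro n
    induction n with
    | zero => exact ⟨0, by simp⟩
    | succ n ih =>
      obtain ⟨k, hk⟩ := ih
      obtain ⟨t, htk, ht⟩ := h k
      refine ⟨t + 1, ?_⟩
      have h1 := sum_le_sum_of_subset_of_nonneg (range_mono htk) fun t _ _ => h0 t
      have h2 := h0 t
      rw [sum_range_succ]
      push_cast
      omega
  obtain ⟨k, hk⟩ := key (B.toNat + 1)
  have := hB k
  push_cast at hk
  omega

theorem not_frequently_decreasing {d : ℕ → ℕ} {Q : ℕ → Prop} {K : ℕ}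
    (hd : ∀ k ≥ K, d (k + 1) ≤ d k) (hQ : ∀ k ≥ K, Q k → d (k + 1) < d k)
    (hfreq : ∀ k, ∃ t ≥ k, Q t) : False := by
  have hanti : ∀ k ≥ K, ∀ t ≥ k, d t ≤ d k := by
    intro k hk t ht
    induction t, ht using Nat.le_induction with
    | base => exact le_rfl
    | succ t ht ih => exact (hd t (hk.le.trans ht)).trans ih
  have key : ∀ n, ∃ k ≥ K, d k + n ≤ d K := by
    intro n
    induction n with
    | zero => exact ⟨K, le_rfl, le_rfl⟩
    | succ n ih =>
      obtain ⟨k, hk, hn⟩ := ih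
      obtain ⟨t, ht, hQt⟩ := hfreq k
      have h1 := hanti k hk t ht
      have h2 := hQ t (hk.le.trans ht) hQt
      exact ⟨t + 1, by omega, by omega⟩
  obtain ⟨k, _, hk⟩ := key (d K + 1)
  omega

end Sequences

theorem Network.ne_of_mem {V : Type*} (N : Network V) {e : V × V} (he : e ∈ N.E) : e.1 ≠ e.2 := by
  rintro h
  apply N.loopless e.1
  rwa [show (e.1, e.1) = e from Prod.ext rfl h]

/-! ### Direction of unit changes -/

section UnitChange

variable {V : Type*} [DecidableEq V] {N : Network V} {j : V} {e : V × V}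

theorem Network.le_unitChange_tail (h : e.2 = j) (x : ℤ) : x ≤ N.unitChange j e x := by
  rw [unitChange, if_pos h]
  split_ifs <;> omega

theorem Network.unitChange_head_le (h : e.2 ≠ j) (x : ℤ) : N.unitChange j e x ≤ x := by
  rw [unitChange, if_neg h]
  split_ifs <;> omega

end UnitChange

variable {V : Type*} [Fintype V] [DecidableEq V]

namespace Network

variable (N : Network V)

/-! ### Balances of nodes and of node sets; edge orders -/

section Balance

theorem sum_inNbrs (g : V × V → ℤ) (j : V) :
    ∑ i ∈ N.inNbrs j, g (j, i) = ∑ e ∈ N.E with e.1 = j, g e := by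
  refine sum_nbij' (fun i => (j, i)) (fun e => e.2) ?_ ?_ ?_ ?_ ?_
  · simp [inNbrs]
  · rintro ⟨a, b⟩ h
    simp only [mem_filter] at h
    obtain ⟨h, rfl⟩ := h
    simpa [inNbrs] using h
  · simp
  · rintro ⟨a, b⟩ h
    simp only [mem_filter] at h
    simp [h.2]
  · simp

theorem sum_outNbrs (g : V × V → ℤ) (j : V) :
    ∑ m ∈ N.outNbrs j, g (m, j) = ∑ e ∈ N.E with e.2 = j, g e := by
  refine sum_nbij' (fun i => (i, j)) (fun e => e.1) ?_ ?_ ?_ ?_ ?_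
  · simp [outNbrs]
  · rintro ⟨a, b⟩ h
    simp only [mem_filter] at h
    obtain ⟨h, rfl⟩ := h
    simpa [outNbrs] using h
  · simp
  · rintro ⟨a, b⟩ h
    simp only [mem_filter] at h
    simp [h.2]
  · simp

theorem balance₂_eq (g f : V × V → ℤ) (j : V) :
    N.balance₂ g f j = ∑ e ∈ N.E with e.1 = j, g e - ∑ e ∈ N.E with e.2 = j, f e := by
  rw [balance₂, sum_inNbrs, sum_outNbrs]

/-- The balances of the nodes in `S` add up to the balance of `S`, when every edge is read with
the flow `p` at its head and `f` at its tail. -/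
theorem sum_balance₂ (p f : V × V → ℤ) (S : Finset V) :
    ∑ j ∈ S, N.balance₂ p f j = ∑ e ∈ N.E with e.1 ∈ S, p e - ∑ e ∈ N.E with e.2 ∈ S, f e := by
  simp only [balance₂_eq, sum_sub_distrib]
  congr 1
  · rw [← sum_fiberwise_of_maps_to (s := {e ∈ N.E | e.1 ∈ S}) (t := S) (g := Prod.fst) (by simp)]
    refine sum_congr rfl fun j hj => sum_congr ?_ fun _ _ => rfl
    ext e
    simp only [mem_filter]
    constructor
    · rintro ⟨h, rfl⟩; exact ⟨⟨h, hj⟩, rfl⟩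
    · rintro ⟨⟨h, _⟩, h'⟩; exact ⟨h, h'⟩
  · rw [← sum_fiberwise_of_maps_to (s := {e ∈ N.E | e.2 ∈ S}) (t := S) (g := Prod.snd) (by simp)]
    refine sum_congr rfl fun j hj => sum_congr ?_ fun _ _ => rfl
    ext e
    simp only [mem_filter]
    constructor
    · rintro ⟨h, rfl⟩; exact ⟨⟨h, hj⟩, rfl⟩
    · rintro ⟨⟨h, _⟩, h'⟩; exact ⟨h, h'⟩

theorem sum_balance_univ (f : V × V → ℤ) : ∑ j, N.balance f j = 0 := by
  simp [balance, sum_balance₂]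

/-- If `S` receives nothing but lower limits and its outgoing edges are at their upper limits, then
the total balance of `S` is not positive. -/
theorem sum_balance₂_nonpos (hcirc : N.CirculationConditions) {p f : V × V → ℤ} {S : Finset V}
    (hpf : ∀ e ∈ N.E, p e ≤ f e)
    (hin : ∀ e ∈ N.E, e.1 ∈ S → e.2 ∉ S → p e ≤ ⌈N.l e⌉)
    (hout : ∀ e ∈ N.E, e.2 ∈ S → e.1 ∉ S → ⌊N.u e⌋ ≤ f e) :
    ∑ j ∈ S, N.balance₂ p f j ≤ 0 := by
  rw [sum_balance₂, ← sum_filter_add_sum_filter_not {e ∈ N.E | e.1 ∈ S} (fun e => e.2 ∈ S),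
    ← sum_filter_add_sum_filter_not {e ∈ N.E | e.2 ∈ S} (fun e => e.1 ∈ S)]
  simp only [filter_filter]
  -- An edge inside `S` contributes `p e` at its head and `-f e` at its tail, which need not cancel
  -- but have nonpositive sum.
  have h1 : ∑ e ∈ N.E with e.1 ∈ S ∧ e.2 ∈ S, p e ≤ ∑ e ∈ N.E with e.2 ∈ S ∧ e.1 ∈ S, f e := by
    simp only [and_comm]
    exact sum_le_sum fun e he => hpf e (mem_filter.1 he).1
  have h2 : ∑ e ∈ N.E with e.1 ∈ S ∧ e.2 ∉ S, p e ≤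
      ∑ e ∈ N.E with e.1 ∈ S ∧ e.2 ∉ S, ⌈N.l e⌉ := sum_le_sum fun e he => by
    obtain ⟨h, h', h''⟩ := mem_filter.1 he
    exact hin e h h' h''
  have h3 : ∑ e ∈ N.E with e.2 ∈ S ∧ e.1 ∉ S, ⌊N.u e⌋ ≤
      ∑ e ∈ N.E with e.2 ∈ S ∧ e.1 ∉ S, f e := sum_le_sum fun e he => by
    obtain ⟨h, h', h''⟩ := mem_filter.1 he
    exact hout e h h' h''
  have h4 := hcirc.2 S
  linarith

theorem balance_view (s : State V) (j : V) : N.balance (s.view j) j = N.perceivedBalance s j := by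
  rw [balance, perceivedBalance, balance₂_eq, balance₂_eq]
  congr 1
  · refine sum_congr rfl fun e he => ?_
    obtain ⟨h, rfl⟩ := mem_filter.1 he
    exact if_neg (N.ne_of_mem h).symm
  · refine sum_congr rfl fun e he => ?_
    exact if_pos (mem_filter.1 he).2

theorem card_incident (j : V) : #(N.incident j) = N.degree j := by
  have h1 : #(N.inNbrs j) = #{e ∈ N.E | e.1 = j} := by
    have := N.sum_inNbrs (fun _ => 1) j
    simpa using this
  have h2 : #(N.outNbrs j) = #{e ∈ N.E | e.2 = j} := by
    have := N.sum_outNbrs (fun _ => 1) j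
    simpa using this
  rw [incident, filter_or, card_union_of_disjoint, degree, h1, h2]
  rw [disjoint_filter]
  rintro e he h h'
  exact N.ne_of_mem he (h.trans h'.symm)

variable {N} {P : V → V × V → ℕ}

/-- By counting: the image has `degree j` elements, as many as there are incident edges, since
without self-loops no edge is both incoming and outgoing. -/
theorem IsEdgeOrder.injOn (hP : N.IsEdgeOrder P) (j : V) :
    Set.InjOn (P j) (N.incident j) := by
  rw [← card_image_iff, hP j, card_range, card_incident]

theorem IsEdgeOrder.lt_degree (hP : N.IsEdgeOrder P) {j : V} {e : V × V}
    (he : e ∈ N.incident j) : P j e < N.degree j := by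
  rw [← mem_range, ← hP j]
  exact mem_image_of_mem _ he

end Balance

/-! ### The round-robin of a single node -/

section RoundRobin

variable {N} {P : V → V × V → ℕ} {j : V} {e : V × V}

theorem le_attempt_tail (h : e.2 = j) (s : Scan V) : s.g e ≤ (N.attempt P j s).g e := by
  unfold attempt
  split_ifs with h1
  · dsimp only
    split_ifs
    · exact le_unitChange_tail h _
    · rfl
  · rfl

theorem attempt_head_le (h : e.2 ≠ j) (s : Scan V) : (N.attempt P j s).g e ≤ s.g e := by
  unfold attempt
  split_ifs with h1
  · dsimp only
    split_ifs
    · exact unitChange_head_le h _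
    · rfl
  · rfl

theorem attempt_tail_le (h : e.2 = j) {s : Scan V} (hs : s.g e ≤ ⌊N.u e⌋) :
    (N.attempt P j s).g e ≤ ⌊N.u e⌋ := by
  unfold attempt
  split_ifs with h1
  · dsimp only
    unfold unitChange
    split_ifs <;> omega
  · exact hs

theorem le_attempt_head (h : e.2 ≠ j) {s : Scan V} (hs : ⌈N.l e⌉ ≤ s.g e) :
    ⌈N.l e⌉ ≤ (N.attempt P j s).g e := by
  unfold attempt
  split_ifs with h1
  · dsimp only
    unfold unitChange
    split_ifs <;> omega
  · exact hs

theorem le_iterate_attempt_tail (h : e.2 = j) (m : ℕ) (s : Scan V) :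
    s.g e ≤ ((N.attempt P j)^[m] s).g e := by
  induction m with
  | zero => rfl
  | succ m ih =>
    rw [Function.iterate_succ_apply']
    exact ih.trans (le_attempt_tail h _)

theorem iterate_attempt_head_le (h : e.2 ≠ j) (m : ℕ) (s : Scan V) :
    ((N.attempt P j)^[m] s).g e ≤ s.g e := by
  induction m with
  | zero => rfl
  | succ m ih =>
    rw [Function.iterate_succ_apply']
    exact (attempt_head_le h _).trans ih

theorem iterate_attempt_tail_le (h : e.2 = j) (m : ℕ) {s : Scan V} (hs : s.g e ≤ ⌊N.u e⌋) :
    ((N.attempt P j)^[m] s).g e ≤ ⌊N.u e⌋ := by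
  induction m with
  | zero => exact hs
  | succ m ih =>
    rw [Function.iterate_succ_apply']
    exact attempt_tail_le h ih

theorem le_iterate_attempt_head (h : e.2 ≠ j) (m : ℕ) {s : Scan V} (hs : ⌈N.l e⌉ ≤ s.g e) :
    ⌈N.l e⌉ ≤ ((N.attempt P j)^[m] s).g e := by
  induction m with
  | zero => exact hs
  | succ m ih =>
    rw [Function.iterate_succ_apply']
    exact le_attempt_head h ih

/-- At most one edge has its turn, because positions are distinct, so a positive integer balance
drops by at most one. -/
theorem attempt_balance_nonneg (hP : N.IsEdgeOrder P) {s : Scan V}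
    (hs : 0 ≤ N.balance s.g j) : 0 ≤ N.balance (N.attempt P j s).g j := by
  by_cases hb : 0 < N.balance s.g j
  swap
  · rwa [attempt, if_neg hb]
  have hcard : #{e ∈ N.incident j | P j e = s.pos} ≤ 1 := by
    rw [card_le_one]
    intro a ha b hb
    obtain ⟨ha, ha'⟩ := mem_filter.1 ha
    obtain ⟨hb, hb'⟩ := mem_filter.1 hb
    exact hP.injOn j ha hb (ha'.trans hb'.symm)
  have key : N.balance s.g j - N.balance (N.attempt P j s).g j ≤
      ∑ e ∈ N.E, if e ∈ N.incident j ∧ P j e = s.pos then (1 : ℤ) else 0 := by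
    simp only [balance, balance₂_eq, sum_filter]
    rw [← sum_sub_distrib, ← sum_sub_distrib, ← sum_sub_distrib]
    refine sum_le_sum fun e he => ?_
    have hne := N.ne_of_mem he
    have hinc : e ∈ N.incident j ↔ e.1 = j ∨ e.2 = j := by simp [incident, he]
    rw [attempt, if_pos hb]
    dsimp only
    unfold unitChange
    by_cases h1 : e.1 = j <;> by_cases h2 : e.2 = j
    · exact absurd (h1.trans h2.symm) hne
    all_goals
      simp only [hinc, h1, h2, or_false, or_true, or_self, true_and, false_and, if_true, if_false]
      (try split_ifs) <;> omega
  rw [← sum_filter, sum_const, nsmul_eq_mul, mul_one] at key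
  have hsub : #{e ∈ N.E | e ∈ N.incident j ∧ P j e = s.pos} ≤ 1 := by
    refine le_trans (card_le_card fun e he => ?_) hcard
    exact mem_filter.2 (mem_filter.1 he).2
  have : (#{e ∈ N.E | e ∈ N.incident j ∧ P j e = s.pos} : ℤ) ≤ 1 := by exact_mod_cast hsub
  omega

theorem iterate_attempt_balance_nonneg (hP : N.IsEdgeOrder P) (m : ℕ) {s : Scan V}
    (hs : 0 ≤ N.balance s.g j) : 0 ≤ N.balance ((N.attempt P j)^[m] s).g j := by
  induction m with
  | zero => exact hs
  | succ m ih =>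
    rw [Function.iterate_succ_apply']
    exact attempt_balance_nonneg hP ih

/-- The number of steps from position `q` to position `r` in the cyclic order of length `D`. -/
def cyclicDist (D r q : ℕ) : ℕ := if q ≤ r then r - q else r + D - q

theorem cyclicDist_succ_lt {D r q : ℕ} (hr : r < D) (hq : q < D) (hne : q ≠ r) :
    cyclicDist D r ((q + 1) % D) < cyclicDist D r q := by
  unfold cyclicDist
  rcases (show q + 1 < D ∨ q + 1 = D by omega) with h | h
  · rw [Nat.mod_eq_of_lt h]
    split_ifs <;> omega
  · rw [h, Nat.mod_self]
    split_ifs <;> omega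

theorem attempt_pos_lt {s : Scan V} (hpos : s.pos < N.degree j) :
    (N.attempt P j s).pos < N.degree j := by
  unfold attempt
  split_ifs
  · exact Nat.mod_lt _ (by omega)
  · exact hpos

theorem iterate_attempt_pos_lt (m : ℕ) {s : Scan V} (hpos : s.pos < N.degree j) :
    ((N.attempt P j)^[m] s).pos < N.degree j := by
  induction m with
  | zero => exact hpos
  | succ m ih =>
    rw [Function.iterate_succ_apply']
    exact attempt_pos_lt ih

/-- An edge that can be changed and is left alone by a number of attempts gets closer to its turn,
strictly so if the first of these attempts is effective. -/
theorem iterate_attempt_cyclicDist (hP : N.IsEdgeOrder P) (he : e ∈ N.incident j) (m : ℕ)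
    {s : Scan V} (hpos : s.pos < N.degree j) (hg : N.unitChange j e (s.g e) ≠ s.g e)
    (hend : ((N.attempt P j)^[m] s).g e = s.g e) :
    cyclicDist (N.degree j) (P j e) ((N.attempt P j)^[m] s).pos ≤
        cyclicDist (N.degree j) (P j e) s.pos ∧
      (0 < m → 0 < N.balance s.g j →
        cyclicDist (N.degree j) (P j e) ((N.attempt P j)^[m] s).pos <
          cyclicDist (N.degree j) (P j e) s.pos) := by
  induction m generalizing s with
  | zero => simp
  | succ m ih =>
    rw [Function.iterate_succ_apply] at hend ⊢
    by_cases hb : 0 < N.balance s.g j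
    swap
    · have hs : N.attempt P j s = s := by rw [attempt, if_neg hb]
      rw [hs] at hend ⊢
      exact ⟨(ih hpos hg hend).1, fun _ h => absurd h hb⟩
    -- If it is the turn of `e`, the possible unit change is carried out, and by monotonicity later
    -- turns cannot undo it, contradicting `hend`.
    by_cases hturn : P j e = s.pos
    · exfalso
      have hs : (N.attempt P j s).g e = N.unitChange j e (s.g e) := by
        rw [attempt, if_pos hb]
        exact if_pos ⟨he, hturn⟩
      by_cases ht : e.2 = j
      · have h1 := le_iterate_attempt_tail (N := N) (P := P) ht m (N.attempt P j s)
        have h2 := le_unitChange_tail (N := N) ht (s.g e)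
        rw [hend, hs] at h1
        exact hg (le_antisymm h1 h2)
      · have h1 := iterate_attempt_head_le (N := N) (P := P) ht m (N.attempt P j s)
        have h2 := unitChange_head_le (N := N) ht (s.g e)
        rw [hend, hs] at h1
        exact hg (le_antisymm h2 h1)
    · have hs : (N.attempt P j s).g e = s.g e := by
        rw [attempt, if_pos hb]
        exact if_neg fun h => hturn h.2
      have hs' : (N.attempt P j s).pos = (s.pos + 1) % N.degree j := by
        rw [attempt, if_pos hb]
      have hlt := cyclicDist_succ_lt (hP.lt_degree he) hpos (Ne.symm hturn)
      have h := (ih (attempt_pos_lt hpos) (by rwa [hs]) (by rwa [hs])).1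
      rw [hs'] at h
      exact ⟨h.trans hlt.le, fun _ _ => h.trans_lt hlt⟩

end RoundRobin

/-! ### Changes desired in one iteration -/

section Change

variable {N} {P : V → V × V → ℕ} {s : State V} {j : V} {e : V × V}

theorem change_tail_nonneg (h : e.2 = j) : 0 ≤ N.change P s j e :=
  sub_nonneg.2 (le_iterate_attempt_tail h _ ⟨s.view j, s.pos j⟩)

theorem change_head_nonpos (h : e.2 ≠ j) : N.change P s j e ≤ 0 :=
  sub_nonpos.2 (iterate_attempt_head_le h _ ⟨s.view j, s.pos j⟩)

theorem add_change_tail_le (h : e.2 = j) (hs : s.f e ≤ ⌊N.u e⌋) :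
    s.f e + N.change P s j e ≤ ⌊N.u e⌋ := by
  have hv : s.view j e = s.f e := if_pos h
  have := iterate_attempt_tail_le (N := N) (P := P) h
    ((N.perceivedBalance s j).toNat * N.degree j) (s := ⟨s.view j, s.pos j⟩) (hv.trans_le hs)
  rw [change, hv, add_sub_cancel]
  exact this

theorem le_add_change_head (h : e.2 ≠ j) (hs : ⌈N.l e⌉ ≤ s.p e) :
    ⌈N.l e⌉ ≤ s.p e + N.change P s j e := by
  have hv : s.view j e = s.p e := if_neg h
  have := le_iterate_attempt_head (N := N) (P := P) h
    ((N.perceivedBalance s j).toNat * N.degree j) (s := ⟨s.view j, s.pos j⟩) (hs.trans_eq hv.symm)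
  rw [change, hv, add_sub_cancel]
  exact this

theorem select_of_nonpos (h : N.perceivedBalance s j ≤ 0) :
    N.select P s j = ⟨s.view j, s.pos j⟩ := by
  rw [select, Int.toNat_of_nonpos h, zero_mul, Function.iterate_zero_apply]

theorem change_of_nonpos (h : N.perceivedBalance s j ≤ 0) : N.change P s j e = 0 := by
  rw [change, select_of_nonpos h, sub_self]

theorem select_balance_nonneg (hP : N.IsEdgeOrder P) (h : 0 ≤ N.perceivedBalance s j) :
    0 ≤ N.balance (N.select P s j).g j :=
  iterate_attempt_balance_nonneg hP _ (by rwa [balance_view])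

theorem select_pos_lt (h : s.pos j < N.degree j) : (N.select P s j).pos < N.degree j :=
  iterate_attempt_pos_lt _ h

theorem select_cyclicDist_lt (hP : N.IsEdgeOrder P) (he : e ∈ N.incident j)
    (hpos : s.pos j < N.degree j) (hb : 0 < N.perceivedBalance s j)
    (hg : N.unitChange j e (s.view j e) ≠ s.view j e) (hc : N.change P s j e = 0) :
    cyclicDist (N.degree j) (P j e) (N.select P s j).pos <
      cyclicDist (N.degree j) (P j e) (s.pos j) := by
  refine (iterate_attempt_cyclicDist hP he _ (s := ⟨s.view j, s.pos j⟩) hpos hg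
    (sub_eq_zero.1 hc)).2 ?_ (by rwa [balance_view])
  -- The number of turns, balance times degree, is nonzero, so the first turn is effective.
  exact Nat.mul_pos (by omega) (by omega)

end Change

/-! ### Evolution of the whole network -/

section Run

variable {N} {P : V → V × V → ℕ} {τ : V → V × V → ℕ → ℕ} {τbar : ℕ}

/-- The change amount that `v` desires on `e` in iteration `k`. -/
noncomputable def runChange (N : Network V) (P : V → V × V → ℕ) (τ : V → V × V → ℕ → ℕ)
    (τbar : ℕ) (v : V) (e : V × V) (k : ℕ) : ℤ :=
  N.change P (N.run P τ τbar k) v e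

theorem run_sent (k : ℕ) (v : V) (e : V × V) (t : ℕ) :
    (N.run P τ τbar k).sent v e t = if t < k then N.runChange P τ τbar v e t else 0 := by
  induction k with
  | zero => rfl
  | succ k ih =>
    change Function.update ((N.run P τ τbar k).sent v e) k (N.change P _ v e) t = _
    by_cases h : t = k
    · subst h
      simp [runChange]
    · rw [Function.update_of_ne h, ih]
      congr 1
      exact propext (by omega)

theorem sentNow_run (k : ℕ) (v : V) (e : V × V) (t : ℕ) :
    N.sentNow P k (N.run P τ τbar k) v e t =
      if t < k + 1 then N.runChange P τ τbar v e t else 0 :=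
  -- By definition `sentNow` is the message record of the state at `k + 1`.
  run_sent (k + 1) v e t

/-- The delay bound guarantees that the window of the last `τbar` iterations misses no message. -/
theorem received_run {v : V} {e : V × V} (hτ : ∀ t, τ v e t ≤ τbar) (k : ℕ) :
    received τ τbar (N.sentNow P k (N.run P τ τbar k)) v e k =
      ∑ t ∈ range (k + 1), if t + τ v e t = k then N.runChange P τ τbar v e t else 0 := by
  rw [received, ← sum_filter]
  refine sum_congr ?_ fun t ht => ?_
  · ext t
    have := hτ t
    simp only [mem_filter, mem_Icc, mem_range]
    omega
  · rw [sentNow_run, if_pos]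
    exact mem_range.1 (mem_filter.1 ht).1

variable {e : V × V}

/-- The projections never take effect: every flow is its initial value plus the changes made by
the holder and those received from the other endpoint. -/
theorem run_flow_eq (hcirc : N.CirculationConditions)
    (hτ : ∀ e ∈ N.E, ∀ k : ℕ, τ e.1 e k ≤ τbar ∧ τ e.2 e k ≤ τbar) (he : e ∈ N.E) (k : ℕ) :
    ((N.run P τ τbar k).f e = ⌈N.l e⌉ + ∑ t ∈ range k, N.runChange P τ τbar e.2 e t +
        arrived (N.runChange P τ τbar e.1 e) (τ e.1 e) k) ∧
      ((N.run P τ τbar k).p e = ⌈N.l e⌉ + ∑ t ∈ range k, N.runChange P τ τbar e.1 e t +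
        arrived (N.runChange P τ τbar e.2 e) (τ e.2 e) k) ∧
      ⌈N.l e⌉ ≤ (N.run P τ τbar k).p e ∧ (N.run P τ τbar k).p e ≤ (N.run P τ τbar k).f e ∧
      (N.run P τ τbar k).f e ≤ ⌊N.u e⌋ := by
  have hne := N.ne_of_mem he
  have htail : ∀ t, 0 ≤ N.runChange P τ τbar e.2 e t := fun t => change_tail_nonneg rfl
  have hhead : ∀ t, N.runChange P τ τbar e.1 e t ≤ 0 := fun t => change_head_nonpos hne.symm
  induction k with
  | zero => simp [run, start, he, arrived, hcirc.1 e he]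
  | succ k ih =>
    obtain ⟨hf, hp, h1, h2, h3⟩ := ih
    have hf' : (N.run P τ τbar (k + 1)).f e = N.proj e ((N.run P τ τbar k).f e +
        N.runChange P τ τbar e.2 e k +
          received τ τbar (N.sentNow P k (N.run P τ τbar k)) e.1 e k) := if_pos he
    have hp' : (N.run P τ τbar (k + 1)).p e = N.proj e ((N.run P τ τbar k).p e +
        N.runChange P τ τbar e.1 e k +
          received τ τbar (N.sentNow P k (N.run P τ τbar k)) e.2 e k) := if_pos he
    have ha := arrived_succ (N.runChange P τ τbar e.1 e) (τ e.1 e) k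
    have hb := arrived_succ (N.runChange P τ τbar e.2 e) (τ e.2 e) k
    rw [← received_run fun t => (hτ e he t).1] at ha
    rw [← received_run fun t => (hτ e he t).2] at hb
    have ha0 : received τ τbar (N.sentNow P k (N.run P τ τbar k)) e.1 e k ≤ 0 := by
      rw [received_run fun t => (hτ e he t).1]
      exact sum_nonpos fun t _ => by split_ifs <;> simp [hhead t]
    have hb0 : 0 ≤ received τ τbar (N.sentNow P k (N.run P τ τbar k)) e.2 e k := by
      rw [received_run fun t => (hτ e he t).2]
      exact sum_nonneg fun t _ => by split_ifs <;> simp [htail t]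
    -- Changes still in transit are decreases missing from `f` and increases missing from `p`; this
    -- gives `p ≤ f` before projection.
    have hsa := sum_le_arrived hhead (τ e.1 e) (k + 1)
    have hsb := arrived_le_sum htail (τ e.2 e) (k + 1)
    have hu : (N.run P τ τbar k).f e + N.runChange P τ τbar e.2 e k ≤ ⌊N.u e⌋ :=
      add_change_tail_le rfl h3
    have hl : ⌈N.l e⌉ ≤ (N.run P τ τbar k).p e + N.runChange P τ τbar e.1 e k :=
      le_add_change_head hne.symm h1
    rw [sum_range_succ] at hsa hsb ⊢
    rw [sum_range_succ]
    -- The unprojected values satisfy `⌈l⌉ ≤ p ≤ f ≤ ⌊u⌋`: the outer bounds are `hl` and `hu`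
    -- combined with the signs of the received amounts. So both projections are trivial.
    rw [hf', hp', proj, proj]
    omega

theorem run_le (hcirc : N.CirculationConditions)
    (hτ : ∀ e ∈ N.E, ∀ k : ℕ, τ e.1 e k ≤ τbar ∧ τ e.2 e k ≤ τbar) (he : e ∈ N.E) (k : ℕ) :
    ⌈N.l e⌉ ≤ (N.run P τ τbar k).p e ∧ (N.run P τ τbar k).p e ≤ (N.run P τ τbar k).f e ∧
      (N.run P τ τbar k).f e ≤ ⌊N.u e⌋ :=
  (run_flow_eq hcirc hτ he k).2.2

/-- Once the endpoints of an edge have stopped changing it and all their messages have arrived,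
they agree on its flow, which remains constant. -/
theorem run_stationary (hcirc : N.CirculationConditions)
    (hτ : ∀ e ∈ N.E, ∀ k : ℕ, τ e.1 e k ≤ τbar ∧ τ e.2 e k ≤ τbar) (he : e ∈ N.E) {K : ℕ}
    (h1 : ∀ t ≥ K, N.runChange P τ τbar e.1 e t = 0)
    (h2 : ∀ t ≥ K, N.runChange P τ τbar e.2 e t = 0) {k : ℕ} (hk : K + τbar ≤ k) :
    (N.run P τ τbar k).p e = (N.run P τ τbar k).f e ∧
      (N.run P τ τbar k).f e = (N.run P τ τbar (K + τbar)).f e := by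
  have key : ∀ k, K + τbar ≤ k → (N.run P τ τbar k).f e = ⌈N.l e⌉ +
      ∑ t ∈ range K, N.runChange P τ τbar e.2 e t + ∑ t ∈ range K, N.runChange P τ τbar e.1 e t ∧
      (N.run P τ τbar k).p e = (N.run P τ τbar k).f e := by
    intro k hk
    obtain ⟨hf, hp, -⟩ := run_flow_eq (P := P) hcirc hτ he k
    rw [arrived_eq_sum (fun t => (hτ e he t).1) h1 hk,
      sum_range_eq_of_eventually_zero h1 (by omega),
      sum_range_eq_of_eventually_zero h2 (by omega)] at hf
    rw [arrived_eq_sum (fun t => (hτ e he t).2) h2 hk,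
      sum_range_eq_of_eventually_zero h1 (by omega),
      sum_range_eq_of_eventually_zero h2 (by omega)] at hp
    exact ⟨hf, by rw [hf, hp]; ring⟩
  exact ⟨(key k hk).2, by rw [(key k hk).1, (key _ le_rfl).1]⟩

/-- Since `f` stays below `⌊u⌋`, the total increase is at most the capacity `⌊u⌋ - ⌈l⌉` plus the
total decrease, which is finite. -/
theorem runChange_tail_eventually_zero (hcirc : N.CirculationConditions)
    (hτ : ∀ e ∈ N.E, ∀ k : ℕ, τ e.1 e k ≤ τbar ∧ τ e.2 e k ≤ τbar) (he : e ∈ N.E) {K : ℕ}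
    (h : ∀ t ≥ K, N.runChange P τ τbar e.1 e t = 0) :
    ∃ K', ∀ t ≥ K', N.runChange P τ τbar e.2 e t = 0 := by
  have hhead : ∀ t, N.runChange P τ τbar e.1 e t ≤ 0 :=
    fun t => change_head_nonpos (N.ne_of_mem he).symm
  refine eventually_zero_of_sum_range_le (fun t => change_tail_nonneg rfl)
    (B := ⌊N.u e⌋ - ⌈N.l e⌉ + ∑ t ∈ range K, -N.runChange P τ τbar e.1 e t) fun k => ?_
  obtain ⟨hf, -, -, -, hu⟩ := run_flow_eq (P := P) hcirc hτ he k
  have h1 := sum_le_arrived hhead (τ e.1 e) k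
  have h2 := sum_range_le_of_eventually_zero (K := K)
    (x := fun t => -N.runChange P τ τbar e.1 e t) (fun t => neg_nonneg.2 (hhead t)) (fun t ht => by simp [h t ht]) k
  simp only [sum_neg_distrib] at h2 ⊢
  omega

/-- Since `p` starts at `⌈l⌉` and never falls below it, the total decrease is at most the total
increase, which is finite. -/
theorem runChange_head_eventually_zero (hcirc : N.CirculationConditions)
    (hτ : ∀ e ∈ N.E, ∀ k : ℕ, τ e.1 e k ≤ τbar ∧ τ e.2 e k ≤ τbar) (he : e ∈ N.E) {K : ℕ}
    (h : ∀ t ≥ K, N.runChange P τ τbar e.2 e t = 0) :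
    ∃ K', ∀ t ≥ K', N.runChange P τ τbar e.1 e t = 0 := by
  have htail : ∀ t, 0 ≤ N.runChange P τ τbar e.2 e t := fun t => change_tail_nonneg rfl
  have hhead : ∀ t, N.runChange P τ τbar e.1 e t ≤ 0 :=
    fun t => change_head_nonpos (N.ne_of_mem he).symm
  suffices hs : ∃ K', ∀ t ≥ K', -N.runChange P τ τbar e.1 e t = 0 by
    simpa only [neg_eq_zero] using hs
  refine eventually_zero_of_sum_range_le (fun t => neg_nonneg.2 (hhead t))
    (B := ∑ t ∈ range K, N.runChange P τ τbar e.2 e t) fun k => ?_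
  obtain ⟨-, hp, hl, -, -⟩ := run_flow_eq (P := P) hcirc hτ he k
  have h1 := arrived_le_sum htail (τ e.2 e) k
  have h2 := sum_range_le_of_eventually_zero htail h k
  simp only [sum_neg_distrib]
  omega

theorem run_pos_lt (j : V) (h : 0 < N.degree j) (k : ℕ) :
    (N.run P τ τbar k).pos j < N.degree j := by
  induction k with
  | zero => exact h
  | succ k ih => exact select_pos_lt ih

/-- If `v` has positive perceived balance infinitely often, but eventually does not change its
incident edge `e`, then it infinitely often holds a saturated flow for `e`. -/
theorem frequently_saturated (hP : N.IsEdgeOrder P) {v : V} (he : e ∈ N.incident v)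
    (hfreq : ∀ k, ∃ t ≥ k, 0 < N.perceivedBalance (N.run P τ τbar t) v) {K : ℕ}
    (hc : ∀ t ≥ K, N.runChange P τ τbar v e t = 0) :
    ∃ k ≥ K, N.unitChange v e ((N.run P τ τbar k).view v e) = (N.run P τ τbar k).view v e := by
  by_contra! hg
  have hpos := run_pos_lt (N := N) (P := P) (τ := τ) (τbar := τbar) v
    ((Nat.zero_le _).trans_lt (hP.lt_degree he))
  have hlt : ∀ k ≥ K, 0 < N.perceivedBalance (N.run P τ τbar k) v →
      cyclicDist (N.degree v) (P v e) ((N.run P τ τbar (k + 1)).pos v) <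
        cyclicDist (N.degree v) (P v e) ((N.run P τ τbar k).pos v) := fun k hk hb =>
    select_cyclicDist_lt hP he (hpos k) hb (hg k hk) (hc k hk)
  -- The cyclic distance from the pointer to `e` drops whenever `v` is active and is unchanged
  -- otherwise, as the pointer then rests; infinite activity is impossible.
  refine not_frequently_decreasing
    (d := fun k => cyclicDist (N.degree v) (P v e) ((N.run P τ τbar k).pos v)) (K := K)
    (fun k hk => ?_) hlt hfreq
  by_cases hb : 0 < N.perceivedBalance (N.run P τ τbar k) v
  · exact (hlt k hk hb).le
  · have : (N.run P τ τbar (k + 1)).pos v = (N.run P τ τbar k).pos v := by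
      change (N.select P (N.run P τ τbar k) v).pos = _
      rw [select_of_nonpos (not_lt.1 hb)]
    simp only [this, le_refl]

/-- The node's own selection never overshoots zero. Messages from tails raise its perceived inflow
and messages from heads lower its outflow, so both push the balance up. -/
theorem perceivedBalance_nonneg_succ (hcirc : N.CirculationConditions) (hP : N.IsEdgeOrder P)
    (hτ : ∀ e ∈ N.E, ∀ k : ℕ, τ e.1 e k ≤ τbar ∧ τ e.2 e k ≤ τbar) {j : V} {k : ℕ}
    (h : 0 ≤ N.perceivedBalance (N.run P τ τbar k) j) :
    0 ≤ N.perceivedBalance (N.run P τ τbar (k + 1)) j := by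
  refine (select_balance_nonneg hP h).trans ?_
  rw [perceivedBalance, balance, balance₂_eq, balance₂_eq]
  refine sub_le_sub (sum_le_sum fun e hmem => ?_) (sum_le_sum fun e hmem => ?_)
  · obtain ⟨he, rfl⟩ := mem_filter.1 hmem
    have hg : (N.select P (N.run P τ τbar k) e.1).g e =
        (N.run P τ τbar k).p e + N.runChange P τ τbar e.1 e k := by
      have hv : (N.run P τ τbar k).view e.1 e = (N.run P τ τbar k).p e :=
        if_neg (N.ne_of_mem he).symm
      rw [runChange, change, hv, add_sub_cancel]
    obtain ⟨-, h1, -⟩ := run_flow_eq (P := P) hcirc hτ he k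
    obtain ⟨-, h2, -⟩ := run_flow_eq (P := P) hcirc hτ he (k + 1)
    rw [arrived_succ, sum_range_succ] at h2
    have h3 : 0 ≤ ∑ t ∈ range (k + 1),
        if t + τ e.2 e t = k then N.runChange P τ τbar e.2 e t else 0 :=
      sum_nonneg fun t _ => by
        split_ifs
        · exact change_tail_nonneg rfl
        · rfl
    omega
  · obtain ⟨he, rfl⟩ := mem_filter.1 hmem
    have hg : (N.select P (N.run P τ τbar k) e.2).g e =
        (N.run P τ τbar k).f e + N.runChange P τ τbar e.2 e k := by
      have hv : (N.run P τ τbar k).view e.2 e = (N.run P τ τbar k).f e := if_pos rfl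
      rw [runChange, change, hv, add_sub_cancel]
    obtain ⟨h1, -⟩ := run_flow_eq (P := P) hcirc hτ he k
    obtain ⟨h2, -⟩ := run_flow_eq (P := P) hcirc hτ he (k + 1)
    rw [arrived_succ, sum_range_succ] at h2
    have h3 : ∑ t ∈ range (k + 1),
        (if t + τ e.1 e t = k then N.runChange P τ τbar e.1 e t else 0) ≤ 0 :=
      sum_nonpos fun t _ => by
        split_ifs
        · exact change_head_nonpos (N.ne_of_mem he).symm
        · rfl
    omega

/-- An outgoing edge of a perpetually active node, whose head is eventually inactive, is
eventually at its upper limit. -/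
theorem eventually_upper (hcirc : N.CirculationConditions) (hP : N.IsEdgeOrder P)
    (hτ : ∀ e ∈ N.E, ∀ k : ℕ, τ e.1 e k ≤ τbar ∧ τ e.2 e k ≤ τbar) (he : e ∈ N.E)
    (hfreq : ∀ k, ∃ t ≥ k, 0 < N.perceivedBalance (N.run P τ τbar t) e.2) {K : ℕ}
    (h : ∀ t ≥ K, N.perceivedBalance (N.run P τ τbar t) e.1 ≤ 0) :
    ∃ K', ∀ k ≥ K', ⌊N.u e⌋ ≤ (N.run P τ τbar k).f e := by
  have h1 : ∀ t ≥ K, N.runChange P τ τbar e.1 e t = 0 := fun t ht => change_of_nonpos (h t ht)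
  obtain ⟨K₂, h2⟩ := runChange_tail_eventually_zero hcirc hτ he h1
  have hconst : ∀ k ≥ max K K₂ + τbar, (N.run P τ τbar k).f e =
      (N.run P τ τbar (max K K₂ + τbar)).f e := fun k hk =>
    (run_stationary hcirc hτ he (fun t ht => h1 t (by omega)) (fun t ht => h2 t (by omega)) hk).2
  obtain ⟨k, hk, hsat⟩ := frequently_saturated hP (by simp [incident, he]) hfreq
    (K := max K K₂ + τbar) fun t ht => h2 t (by omega)
  refine ⟨max K K₂ + τbar, fun k' hk' => ?_⟩
  -- Saturation at the single time `k` carries over to every time from the threshold on, the flow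
  -- being constant there.
  rw [hconst k' hk', ← hconst k hk]
  have hv : (N.run P τ τbar k).view e.2 e = (N.run P τ τbar k).f e := if_pos rfl
  rw [hv, unitChange, if_pos rfl] at hsat
  split_ifs at hsat <;> omega

/-- An incoming edge of a perpetually active node, whose tail is eventually inactive, is
eventually at its lower limit. -/
theorem eventually_lower (hcirc : N.CirculationConditions) (hP : N.IsEdgeOrder P)
    (hτ : ∀ e ∈ N.E, ∀ k : ℕ, τ e.1 e k ≤ τbar ∧ τ e.2 e k ≤ τbar) (he : e ∈ N.E)
    (hfreq : ∀ k, ∃ t ≥ k, 0 < N.perceivedBalance (N.run P τ τbar t) e.1) {K : ℕ}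
    (h : ∀ t ≥ K, N.perceivedBalance (N.run P τ τbar t) e.2 ≤ 0) :
    ∃ K', ∀ k ≥ K', (N.run P τ τbar k).p e ≤ ⌈N.l e⌉ := by
  have h2 : ∀ t ≥ K, N.runChange P τ τbar e.2 e t = 0 := fun t ht => change_of_nonpos (h t ht)
  obtain ⟨K₁, h1⟩ := runChange_head_eventually_zero hcirc hτ he h2
  have hconst : ∀ k ≥ max K K₁ + τbar, (N.run P τ τbar k).p e =
      (N.run P τ τbar (max K K₁ + τbar)).f e := fun k hk => by
    obtain ⟨ha, hb⟩ := run_stationary hcirc hτ he (K := max K K₁) (fun t ht => h1 t (by omega))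
      (fun t ht => h2 t (by omega)) hk
    exact ha.trans hb
  obtain ⟨k, hk, hsat⟩ := frequently_saturated hP (by simp [incident, he]) hfreq
    (K := max K K₁ + τbar) fun t ht => h1 t (by omega)
  refine ⟨max K K₁ + τbar, fun k' hk' => ?_⟩
  rw [hconst k' hk', ← hconst k hk]
  have hne := (N.ne_of_mem he).symm
  have hv : (N.run P τ τbar k).view e.1 e = (N.run P τ τbar k).p e := if_neg hne
  rw [hv, unitChange, if_neg hne] at hsat
  split_ifs at hsat <;> omega

/-- Every node is eventually inactive. -/
theorem eventually_perceivedBalance_nonpos (hcirc : N.CirculationConditions)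
    (hP : N.IsEdgeOrder P)
    (hτ : ∀ e ∈ N.E, ∀ k : ℕ, τ e.1 e k ≤ τbar ∧ τ e.2 e k ≤ τbar) (j : V) :
    ∃ K, ∀ k ≥ K, N.perceivedBalance (N.run P τ τbar k) j ≤ 0 := by
  classical
  by_contra! hj
  let S : Finset V := {v | ∀ k, ∃ t ≥ k, 0 < N.perceivedBalance (N.run P τ τbar t) v}
  have hS : ∀ v, v ∈ S ↔ ∀ k, ∃ t ≥ k, 0 < N.perceivedBalance (N.run P τ τbar t) v := by
    simp [S]
  have hS' : ∀ v, v ∉ S → ∃ K, ∀ k ≥ K, N.perceivedBalance (N.run P τ τbar k) v ≤ 0 := by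
    intro v hv
    rw [hS] at hv
    push Not at hv
    exact hv
  have hnonneg : ∀ v, ∀ᶠ k in Filter.atTop,
      v ∈ S → 0 ≤ N.perceivedBalance (N.run P τ τbar k) v := by
    intro v
    by_cases hv : v ∈ S
    · obtain ⟨t, -, ht⟩ := (hS v).1 hv 0
      refine Filter.eventually_atTop.2 ⟨t, fun k hk _ => ?_⟩
      induction k, hk using Nat.le_induction with
      | base => exact ht.le
      | succ k hk ih => exact perceivedBalance_nonneg_succ hcirc hP hτ ih
    · exact Filter.Eventually.of_forall fun k h => absurd h hv
  have hin : ∀ e : V × V, ∀ᶠ k in Filter.atTop,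
      e ∈ N.E → e.1 ∈ S → e.2 ∉ S → (N.run P τ τbar k).p e ≤ ⌈N.l e⌉ := by
    intro e
    by_cases h : e ∈ N.E ∧ e.1 ∈ S ∧ e.2 ∉ S
    · obtain ⟨he, h1, h2⟩ := h
      obtain ⟨K, hK⟩ := hS' _ h2
      obtain ⟨K', hK'⟩ := eventually_lower hcirc hP hτ he ((hS _).1 h1) hK
      exact Filter.eventually_atTop.2 ⟨K', fun k hk _ _ _ => hK' k hk⟩
    · exact Filter.Eventually.of_forall fun k h1 h2 h3 => absurd ⟨h1, h2, h3⟩ h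
  have hout : ∀ e : V × V, ∀ᶠ k in Filter.atTop,
      e ∈ N.E → e.2 ∈ S → e.1 ∉ S → ⌊N.u e⌋ ≤ (N.run P τ τbar k).f e := by
    intro e
    by_cases h : e ∈ N.E ∧ e.2 ∈ S ∧ e.1 ∉ S
    · obtain ⟨he, h1, h2⟩ := h
      obtain ⟨K, hK⟩ := hS' _ h2
      obtain ⟨K', hK'⟩ := eventually_upper hcirc hP hτ he ((hS _).1 h1) hK
      exact Filter.eventually_atTop.2 ⟨K', fun k hk _ _ _ => hK' k hk⟩
    · exact Filter.Eventually.of_forall fun k h1 h2 h3 => absurd ⟨h1, h2, h3⟩ h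
  -- There are finitely many nodes and edges, so one threshold serves all; `j` is active at some
  -- time beyond it.
  obtain ⟨K, hK⟩ := Filter.eventually_atTop.1 ((Filter.eventually_all.2 hnonneg).and
    ((Filter.eventually_all.2 hin).and (Filter.eventually_all.2 hout)))
  obtain ⟨k, hk, hpos⟩ := hj K
  obtain ⟨ha, hb, hc⟩ := hK k hk
  have hle : ∑ v ∈ S, N.perceivedBalance (N.run P τ τbar k) v ≤ 0 :=
    N.sum_balance₂_nonpos hcirc (fun e he => (run_le hcirc hτ he k).2.1) hb hc
  exact hle.not_gt (sum_pos' (fun v hv => ha v hv) ⟨j, (hS j).2 hj, hpos⟩)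

end Run

end Network

end FlowBalancing

theorem proposition4 {V : Type*} [Fintype V] [DecidableEq V] (hn : 2 ≤ Fintype.card V)
    (N : FlowBalancing.Network V) (hconn : N.StronglyConnected)
    (hlu : ∀ e ∈ N.E, 0 < N.l e ∧ N.l e ≤ N.u e)
    (hcirc : N.CirculationConditions)
    (P : V → V × V → ℕ) (hP : N.IsEdgeOrder P)
    (τ : V → V × V → ℕ → ℕ) (τbar : ℕ)
    (hτ : ∀ e ∈ N.E, ∀ k : ℕ, τ e.1 e k ≤ τbar ∧ τ e.2 e k ≤ τbar) :
    ∃ k₀ : ℕ, ∀ k ≥ k₀,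
      (∀ e ∈ N.E, N.flow P τ τbar k e = N.flow P τ τbar k₀ e ∧
        0 < N.l e ∧ N.l e ≤ (N.flow P τ τbar k e : ℝ) ∧ (N.flow P τ τbar k e : ℝ) ≤ N.u e) ∧
      ∀ j : V, N.balance (N.flow P τ τbar k) j = 0 := by
  obtain ⟨K, hK⟩ := Filter.eventually_atTop.1 (Filter.eventually_all.2 fun j =>
    Filter.eventually_atTop.2
      (FlowBalancing.Network.eventually_perceivedBalance_nonpos (N := N) hcirc hP hτ j))
  have hstat : ∀ e ∈ N.E, ∀ k ≥ K + τbar, (N.run P τ τbar k).p e = (N.run P τ τbar k).f e ∧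
      (N.run P τ τbar k).f e = (N.run P τ τbar (K + τbar)).f e := fun e he k hk =>
    FlowBalancing.Network.run_stationary hcirc hτ he
      (fun t ht => FlowBalancing.Network.change_of_nonpos (hK t ht e.1))
      (fun t ht => FlowBalancing.Network.change_of_nonpos (hK t ht e.2)) hk
  -- No node acts from `K` on, and the last messages have arrived `τbar` iterations later.
  refine ⟨K + τbar, fun k hk => ⟨fun e he => ⟨(hstat e he k hk).2, (hlu e he).1, ?_, ?_⟩, ?_⟩⟩
  · obtain ⟨h1, h2, -⟩ := FlowBalancing.Network.run_le (P := P) hcirc hτ he k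
    exact Int.ceil_le.1 (h1.trans h2)
  · exact Int.le_floor.1 (FlowBalancing.Network.run_le (P := P) hcirc hτ he k).2.2
  -- As `p = f` by now, perceived and actual balances coincide.
  · have hbal : ∀ j, N.balance (N.flow P τ τbar k) j ≤ 0 := by
      intro j
      refine le_of_eq_of_le ?_ (hK k (by omega) j)
      rw [FlowBalancing.Network.perceivedBalance, FlowBalancing.Network.balance,
        FlowBalancing.Network.balance₂_eq, FlowBalancing.Network.balance₂_eq]
      congr 1
      exact Finset.sum_congr rfl fun e he => (hstat e (Finset.mem_filter.1 he).1 k hk).1.symm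
    intro j
    exact (Finset.sum_eq_zero_iff_of_nonpos fun j _ => hbal j).1
      (N.sum_balance_univ (N.flow P τ τbar k)) j (Finset.mem_univ j)
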